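/- **Theorem (Linear convergence of relaxed ADMM).** Let $\mathcal H_1,\mathcal H_2,\mathcal G$ be real Hilbert spaces, let $f:\mathcal H_1\to(-\infty,\infty]$ and $g:\mathcal H_2\to(-\infty,\infty]$ be closed, proper and convex, let $A:\mathcal H_1\to\mathcal G$ and $B:\mathcal H_2\to\mathcal G$ be bounded linear operators with $\|A\|\|B\|\neq 0$, and let $b\in\mathcal G$. Let $\mu_f,\mu_g,\beta_f,\beta_g,\alpha_A,\alpha_B\ge 0$ be such that $f$ and $g$ are $\mu_f$- and $\mu_g$-strongly convex; if $\beta_f>0$ (respectively $\beta_g>0$), then $f$ (respectively $g$) is finite and Fréchet differentiable everywhere with $(1/\beta_f)$- (respectively $(1/\beta_g)$-) Lipschitz gradient; and $\langle AA^*w,w\rangle\ge\alpha_A\|w\|^2$, $\langle BB^*w,w\rangle\ge\alpha_B\|w\|^2$ for all $w\in\mathcal G$ (each constant may be $0$, which means no condition beyond convexity). Put $$d_f(w)=f^*(A^*w),\qquad d_g(w)=g^*(B^*w)-\langle w,b\rangle ,$$ where $^*$ on functions is the convex conjugate, and assume that $0\in\partial d_f(w)+\partial d_g(w)$ for some $w\in\mathcal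 G$. Let $\gamma>0$ and $(\lambda_k)_{k\ge0}\subset(0,1]$. With $\mathrm{prox}_{\gamma d}(z)=\operatorname{argmin}_{w}\, d(w)+\frac1{2\gamma}\|w-z\|^2$ and $\mathrm{refl}_{\gamma d}=2\,\mathrm{prox}_{\gamma d}-I$, put $T=\mathrm{refl}_{\gamma d_f}\circ\mathrm{refl}_{\gamma d_g}$, and let $z^*$ be a fixed point of $T$. Let $(z^k)_{k\ge0}\subset\mathcal G$ be either * any sequence of relaxed Peaceman–Rachford splitting applied to the dual problem, $z^{k+1}=(1-\lambda_k)z^k+\lambda_kTz^k$; or * the sequence attached to a run of relaxed ADMM, that is, to $w^{-1}\in\mathcal G$, $x^{-1}=0$, $y^{-1}=0$, $\lambda_{-1}=\frac12$ and, for $k\ge-1$, with $r^k:=Ax^k+By^k-b$, $$\begin{aligned} y^{k+1}&\in\operatorname{argmin}_y\ g(y)-\langle w^k,Ax^k+By-b\rangle+\tfrac\gamma2\|Ax^k+By-b+(2\lambda_k-1)r^k\|^2,\\ w^{k+1}&=w^k-\gamma(Ax^k+By^{k+1}-b)-\gamma(2\lambda_k-1)r^k,\\ x^{k+1}&\in\operatorname{argmin}_x\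 f(x)-\langle w^{k+1},Ax+By^{k+1}-b\rangle+\tfrac\gamma2\|Ax+By^{k+1}-b\|^2, \end{aligned}$$ through $z^0=w^{-1}$ and $z^{k+1}=z^k-2\gamma\lambda_k(Ax^k+By^k-b)$ for $k\ge0$. Say that $(z^k)$ converges linearly to $z^*$ if there is $r\in[0,1)$ with $\|z^{k+1}-z^*\|\le r\|z^k-z^*\|$ for all $k\ge 0$. Then the following hold. 1. If $\mu_g\beta_g\alpha_B>0$, then for all $k\ge0$ $$\|z^{k+1}-z^*\|\le\Bigl(1-\frac{4\gamma\lambda_k\beta_g\alpha_B}{(1+\gamma\|B\|^2/\mu_g)^2}\Bigr)^{1/2}\|z^k-z^*\|,$$ and if $\inf_k\lambda_k>0$, then $(z^k)$ converges linearly to $z^*$. 2. If $\mu_f\beta_f\alpha_A>0$, then for all $k\ge0$ $$\|z^{k+1}-z^*\|\le\Bigl(1-\frac{\lambda_k}{2}\min\Bigl\{\frac{4\gamma\beta_f\alpha_A}{(1+\gamma\|A\|^2/\mu_f)^2},\,1-\lambda_k\Bigr\}\Bigr)^{1/2}\|z^k-z^*\|,$$ and if $\inf_k\lambda_k>0$,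 then $(z^k)$ converges linearly to $z^*$. 3. If $\mu_f\beta_g\alpha_B>0$, then for all $k\ge0$ $$\|z^{k+1}-z^*\|\le\Bigl(1-\frac{4\lambda_k}{3}\min\Bigl\{\gamma\beta_g\alpha_B,\,\frac{\mu_f}{\|A\|^2\gamma},\,1-\lambda_k\Bigr\}\Bigr)^{1/2}\|z^k-z^*\|,$$ and if $\inf_k\lambda_k(1-\lambda_k)>0$, then $(z^k)$ converges linearly to $z^*$. 4. If $\mu_g\beta_f\alpha_A>0$, then for all $k\ge0$ $$\|z^{k+1}-z^*\|\le\Bigl(1-\frac{4\lambda_k}{3}\min\Bigl\{\gamma\beta_f\alpha_A,\,\frac{\mu_g}{\|B\|^2\gamma},\,1-\lambda_k\Bigr\}\Bigr)^{1/2}\|z^k-z^*\|,$$ and if $\inf_k\lambda_k(1-\lambda_k)>0$, then $(z^k)$ converges linearly to $z^*$. -/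

import Mathlib

namespace RelaxedADMM

section Convex

variable {H : Type*} [NormedAddCommGroup H] [InnerProductSpace ℝ H]

/-- Strong convexity with modulus `μ ≥ 0` of a function with values in `(-∞, ∞]`;
`μ = 0` is plain convexity. -/
def StronglyConvex (μ : ℝ) (f : H → EReal) : Prop :=
  ∀ (x y : H) (a b : ℝ), 0 < a → 0 < b → a + b = 1 →
    f (a • x + b • y) + ((μ / 2 * a * b * ‖x - y‖ ^ 2 : ℝ) : EReal)
      ≤ (a : EReal) * f x + (b : EReal) * f y

/-- Closed, proper and convex functions `f : H → (-∞, ∞]`. -/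
structure ClosedProperConvex (f : H → EReal) : Prop where
  ne_bot : ∀ x, f x ≠ ⊥
  exists_ne_top : ∃ x, f x ≠ ⊤
  closed : LowerSemicontinuous f
  convex : ∀ (x y : H) (a b : ℝ), 0 < a → 0 < b → a + b = 1 →
    f (a • x + b • y) ≤ (a : EReal) * f x + (b : EReal) * f y

/-- The convention "the gradient of `f` is `(1/β)`-Lipschitz": for `β > 0` the function `f` is
finite and Fréchet differentiable on the whole space with `(1/β)`-Lipschitz gradient, and
for `β = 0` nothing is required. -/
def LipschitzGradient [CompleteSpace H] (β : ℝ) (f : H → EReal) : Prop :=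
  0 < β → ∃ (F : H → ℝ) (F' : H → H), (∀ x, f x = (F x : EReal)) ∧
    (∀ x, HasGradientAt F (F' x) x) ∧ ∀ x y, ‖F' x - F' y‖ ≤ 1 / β * ‖x - y‖

/-- The convex subdifferential of `f` at `x` (empty where `f x = ∞`). -/
def subdifferential (f : H → EReal) (x : H) : Set H :=
  {u | f x ≠ ⊤ ∧ ∀ y, f x + ((inner ℝ u (y - x) : ℝ) : EReal) ≤ f y}

/-- The convex conjugate `f^*(u) = sup_x ⟨u, x⟩ - f x`. -/
noncomputable def conjugate (f : H → EReal) (u : H) : EReal :=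
  ⨆ x, ((inner ℝ u x : ℝ) : EReal) - f x

/-- `p = prox_{γ f}(x)`, that is, `p` minimizes `y ↦ f y + (1/(2γ)) ‖y - x‖²`. -/
def IsProx (γ : ℝ) (f : H → EReal) (x p : H) : Prop :=
  IsMinOn (fun y => f y + ((1 / (2 * γ) * ‖y - x‖ ^ 2 : ℝ) : EReal)) Set.univ p

/-- `r = refl_{γ f}(x) = 2 prox_{γ f}(x) - x`. -/
def IsRefl (γ : ℝ) (f : H → EReal) (x r : H) : Prop :=
  ∃ p, IsProx γ f x p ∧ r = (2 : ℝ) • p - x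

/-- `t = T_PRS(z)`, where `T_PRS = refl_{γ f} ∘ refl_{γ g}`. -/
def IsPRSImage (γ : ℝ) (f g : H → EReal) (z t : H) : Prop :=
  ∃ r, IsRefl γ g z r ∧ IsRefl γ f r t

/-- `z^{k+1} = (1 - λ_k) z^k + λ_k T_PRS(z^k)` for all `k ≥ 0`. -/
def IsRelaxedPRS (γ : ℝ) (lam : ℕ → ℝ) (f g : H → EReal) (z : ℕ → H) : Prop :=
  ∀ k, ∃ t, IsPRSImage γ f g (z k) t ∧ z (k + 1) = (1 - lam k) • z k + lam k • t

/-- Linear convergence of `z` to `zs`: one ratio `r < 1` for all steps. -/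
def ConvergesLinearly (z : ℕ → H) (zs : H) : Prop :=
  ∃ r : ℝ, 0 ≤ r ∧ r < 1 ∧ ∀ k, ‖z (k + 1) - zs‖ ≤ r * ‖z k - zs‖

/-- `L` is `α`-strongly monotone. -/
def StronglyMonotone (α : ℝ) (L : H →L[ℝ] H) : Prop :=
  ∀ w, α * ‖w‖ ^ 2 ≤ inner ℝ (L w) w

end Convex

section ADMM

variable {H₁ H₂ G : Type*}
  [NormedAddCommGroup H₁] [InnerProductSpace ℝ H₁] [CompleteSpace H₁]
  [NormedAddCommGroup H₂] [InnerProductSpace ℝ H₂] [CompleteSpace H₂]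
  [NormedAddCommGroup G] [InnerProductSpace ℝ G] [CompleteSpace G]

/-- `d_f(w) = f^*(A^* w)`. -/
noncomputable def dualF (f : H₁ → EReal) (A : H₁ →L[ℝ] G) (w : G) : EReal :=
  conjugate f (A.adjoint w)

/-- `d_g(w) = g^*(B^* w) - ⟨w, b⟩`. -/
noncomputable def dualG (g : H₂ → EReal) (B : H₂ →L[ℝ] G) (b : G) (w : G) : EReal :=
  conjugate g (B.adjoint w) - ((inner ℝ w b : ℝ) : EReal)

/-- The relaxation parameters with the initial value `λ_{-1} = 1/2` put in front:
position `j` holds `λ_{j-1}`. -/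
noncomputable def shiftedRelaxation (lam : ℕ → ℝ) : ℕ → ℝ
  | 0 => 1 / 2
  | k + 1 => lam k

/-- Relaxed ADMM, with the sequences `x, y, w` started at the index `-1`: position `j` of
`x`, `y`, `w` holds `x^{j-1}`, `y^{j-1}`, `w^{j-1}`. The sequence `z` is the one attached to it:
`z^0 = w^{-1}` and `z^{k+1} = z^k - 2 γ λ_k (A x^k + B y^k - b)`. -/
structure IsRelaxedADMM (γ : ℝ) (lam : ℕ → ℝ) (f : H₁ → EReal) (g : H₂ → EReal)
    (A : H₁ →L[ℝ] G) (B : H₂ →L[ℝ] G) (b : G)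
    (x : ℕ → H₁) (y : ℕ → H₂) (w z : ℕ → G) : Prop where
  x_init : x 0 = 0
  y_init : y 0 = 0
  y_step : ∀ j, IsMinOn (fun v => g v +
      ((-inner ℝ (w j) (A (x j) + B v - b) + γ / 2 * ‖A (x j) + B v - b +
        (2 * shiftedRelaxation lam j - 1) • (A (x j) + B (y j) - b)‖ ^ 2 : ℝ) : EReal))
      Set.univ (y (j + 1))
  w_step : ∀ j, w (j + 1) = w j - γ • (A (x j) + B (y (j + 1)) - b)
      - (γ * (2 * shiftedRelaxation lam j - 1)) • (A (x j) + B (y j) - b)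
  x_step : ∀ j, IsMinOn (fun u => f u +
      ((-inner ℝ (w (j + 1)) (A u + B (y (j + 1)) - b)
        + γ / 2 * ‖A u + B (y (j + 1)) - b‖ ^ 2 : ℝ) : EReal))
      Set.univ (x (j + 1))
  z_init : z 0 = w 0
  z_step : ∀ k, z (k + 1) = z k - (2 * γ * lam k) • (A (x (k + 1)) + B (y (k + 1)) - b)

end ADMM

end RelaxedADMM

/-!
On the dual side both iterations are the same: a run of relaxed ADMM is a run of relaxed
Peaceman–Rachford splitting for `d_f` and `d_g` (`IsRelaxedADMM.isRelaxedPRS`), because the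
optimality condition of a primal subproblem exhibits a subgradient of the dual function
(`mem_subdifferential_dualG`), and `s ∈ ∂d(p)` says that `p` is the proximal point of `p + γ s`.

Comparing a step from `z` with the fixed point yields differences `(w₁, s₁)` and `(w₂, s₂)` of
points in the graphs of `∂d_g` and `∂d_f` such that `z - z* = w₁ + γ s₁`,
`w₁ - γ s₁ = w₂ + γ s₂`, and `T z - z* = w₂ - γ s₂`. Everything then follows from
`‖w - γ s‖² = ‖w + γ s‖² - 4 γ ⟪w, s⟫` and lower bounds for the two inner products `⟪wᵢ, sᵢ⟫`.

These bounds come from duality. If `f` has a `(1/β)`-Lipschitz gradient, then its conjugate is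
`β`-strongly convex (`stronglyConvex_conjugate`), so `∂d_f` is `β α`-strongly monotone
(`StronglyConvex.le_inner_sub`). If `f` is `μ`-strongly convex, then its conjugate is
`(1/μ)`-smooth (`convexlySmooth_conjugate`), so `∂d_f` is Lipschitz and cocoercive with constant
`L = ‖A‖² / μ` (`ConvexlySmooth.norm_sub_le`, `ConvexlySmooth.norm_sq_le_inner_sub`). Smoothness is
expressed by an inequality between function values, which passes through conjugation without any
attainment of suprema and makes sense for functions with values in `(-∞, ∞]`.

If both properties belong to the same function, its reflection is a strict contraction
(`norm_sub_smul_sq_le`) and the other one is nonexpansive. If they belong to different functions,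
neither reflection need contract, but `z - z*` is a sum of the residual `w₁ - w₂`, which the
relaxation controls with weight `1 - λ`, and one vector from each of the two pairs, controlled by
strong monotonicity and by cocoercivity (`norm_relaxed_step_sq_le_of_split`).
-/

namespace RelaxedADMM

/-! ### Extended real numbers -/

section Auxiliary

lemma exists_real_eq {X : EReal} (hbot : X ≠ ⊥) (htop : X ≠ ⊤) : ∃ r : ℝ, X = r :=
  ⟨X.toReal, (EReal.coe_toReal htop hbot).symm⟩

/-- To bound a number by a convex combination of `X, Y ∈ (-∞, ∞]`, one may assume that `X` and `Y`
are finite. -/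
lemma le_convexCombination {e X Y : EReal} {a b : ℝ} (ha : 0 < a) (hb : 0 < b)
    (hX : X ≠ ⊥) (hY : Y ≠ ⊥)
    (h : ∀ x y : ℝ, X = x → Y = y → e ≤ ((a * x + b * y : ℝ) : EReal)) :
    e ≤ (a : EReal) * X + (b : EReal) * Y := by
  have aux : ∀ {c : ℝ} {Z : EReal}, 0 < c → Z ≠ ⊥ → (c : EReal) * Z ≠ ⊥ := by
    intro c Z hc hZ
    induction Z with
    | bot => exact absurd rfl hZ
    | coe z => exact_mod_cast EReal.coe_ne_bot (c * z)
    | top => rw [EReal.coe_mul_top_of_pos hc]; simp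
  by_cases hX' : X = ⊤
  · rw [hX', EReal.coe_mul_top_of_pos ha, EReal.top_add_of_ne_bot (aux hb hY)]
    exact le_top
  by_cases hY' : Y = ⊤
  · rw [hY', EReal.coe_mul_top_of_pos hb, EReal.add_top_of_ne_bot (aux ha hX)]
    exact le_top
  obtain ⟨x, rfl⟩ := exists_real_eq hX hX'
  obtain ⟨y, rfl⟩ := exists_real_eq hY hY'
  have := h x y rfl rfl
  exact_mod_cast this

lemma le_of_forall_le_add_mul {X Y c : ℝ} (h : ∀ t : ℝ, 0 < t → t < 1 → X ≤ Y + t * c) :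
    X ≤ Y := by
  have hlim : Filter.Tendsto (fun t : ℝ => Y + t * c) (nhdsWithin 0 (Set.Ioi 0)) (nhds Y) := by
    have : Filter.Tendsto (fun t : ℝ => Y + t * c) (nhds 0) (nhds (Y + 0 * c)) :=
      Continuous.tendsto (by fun_prop) 0
    rw [zero_mul, add_zero] at this
    exact this.mono_left nhdsWithin_le_nhds
  refine ge_of_tendsto hlim ?_
  filter_upwards [Ioo_mem_nhdsGT (zero_lt_one (α := ℝ))] with t ht
  exact h t ht.1 ht.2

end Auxiliary

/-! ### Subgradients and proximal points -/

section Subgradient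

variable {H : Type*} [NormedAddCommGroup H] [InnerProductSpace ℝ H]

lemma StronglyConvex.convex {σ : ℝ} {d : H → EReal} (hd : StronglyConvex σ d) (hσ : 0 ≤ σ)
    (x y : H) (a b : ℝ) (ha : 0 < a) (hb : 0 < b) (hab : a + b = 1) :
    d (a • x + b • y) ≤ (a : EReal) * d x + (b : EReal) * d y := by
  refine le_trans ?_ (hd x y a b ha hb hab)
  have h0 : (0 : EReal) ≤ ((σ / 2 * a * b * ‖x - y‖ ^ 2 : ℝ) : EReal) := by
    exact_mod_cast (by positivity : (0 : ℝ) ≤ σ / 2 * a * b * ‖x - y‖ ^ 2)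
  simpa using add_le_add_right h0 (d (a • x + b • y))

lemma le_of_mem_subdifferential {d : H → EReal} {x y u : H} {r s : ℝ}
    (hu : u ∈ subdifferential d x) (hr : d x = r) (hs : d y = s) :
    r + inner ℝ u (y - x) ≤ s := by
  have := hu.2 y
  rw [hr, hs] at this
  exact_mod_cast this

lemma StronglyConvex.zero_of_nonneg {σ : ℝ} {d : H → EReal} (hd : StronglyConvex σ d) (hσ : 0 ≤ σ) :
    StronglyConvex 0 d := by
  intro x y a b ha hb hab
  simpa using hd.convex hσ x y a b ha hb hab

/-- Fermat's rule for the sum of a convex function and a function which is quadratic along rays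
from the minimizer `p`: minus the gradient of the latter is a subgradient of the former. -/
lemma mem_subdifferential_of_isMinOn_add {d : H → EReal} (hbot : ∀ x, d x ≠ ⊥)
    (htop : ∃ x, d x ≠ ⊤)
    (hconv : ∀ (x y : H) (a b : ℝ), 0 < a → 0 < b → a + b = 1 →
      d (a • x + b • y) ≤ (a : EReal) * d x + (b : EReal) * d y)
    {q : H → ℝ} {p u : H} (hmin : IsMinOn (fun v => d v + (q v : EReal)) Set.univ p)
    (hq : ∀ h, ∃ c, ∀ t : ℝ, q (p + t • h) ≤ q p - t * inner ℝ u h + t ^ 2 * c) :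
    u ∈ subdifferential d p := by
  have hmin' : ∀ v, d p + (q p : EReal) ≤ d v + (q v : EReal) := fun v => hmin (Set.mem_univ v)
  have hp : d p ≠ ⊤ := by
    intro hp
    obtain ⟨x, hx⟩ := htop
    obtain ⟨r, hr⟩ := exists_real_eq (hbot x) hx
    have := hmin' x
    rw [hp, hr, EReal.top_add_coe] at this
    exact absurd (top_le_iff.1 this) (EReal.coe_ne_top (r + q x))
  refine ⟨hp, fun y => ?_⟩
  by_cases hy : d y = ⊤
  · rw [hy]; exact le_top
  obtain ⟨r, hr⟩ := exists_real_eq (hbot p) hp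
  obtain ⟨s, hs⟩ := exists_real_eq (hbot y) hy
  obtain ⟨c, hc⟩ := hq (y - p)
  rw [hr, hs]
  suffices h : r + inner ℝ u (y - p) ≤ s by exact_mod_cast h
  refine le_of_forall_le_add_mul (c := c) fun t ht0 ht1 => ?_
  have h1 := hconv p y (1 - t) t (by linarith) ht0 (by ring)
  have h2 := hmin' (p + t • (y - p))
  have he : (1 - t) • p + t • y = p + t • (y - p) := by module
  rw [he, hr, hs] at h1
  have h3 : ((r + q p : ℝ) : EReal)
      ≤ (((1 - t) * r + t * s + q (p + t • (y - p)) : ℝ) : EReal) := by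
    rw [hr] at h2
    push_cast
    push_cast at h1
    exact h2.trans (add_le_add_left h1 _)
  have h4 : r + q p ≤ (1 - t) * r + t * s + q (p + t • (y - p)) := by exact_mod_cast h3
  have h5 := hc t
  have h6 : t * (r + inner ℝ u (y - p)) ≤ t * (s + t * c) := by nlinarith
  exact le_of_mul_le_mul_left h6 ht0

lemma IsProx.mem_subdifferential {γ : ℝ} (hγ : 0 < γ) {d : H → EReal} (hbot : ∀ x, d x ≠ ⊥)
    (htop : ∃ x, d x ≠ ⊤)
    (hconv : ∀ (x y : H) (a b : ℝ), 0 < a → 0 < b → a + b = 1 →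
      d (a • x + b • y) ≤ (a : EReal) * d x + (b : EReal) * d y)
    {z p : H} (hp : IsProx γ d z p) : γ⁻¹ • (z - p) ∈ subdifferential d p := by
  refine mem_subdifferential_of_isMinOn_add hbot htop hconv
    (q := fun y => 1 / (2 * γ) * ‖y - z‖ ^ 2) hp fun h => ⟨1 / (2 * γ) * ‖h‖ ^ 2, fun t => ?_⟩
  have he : p + t • h - z = (p - z) + t • h := by abel
  have hs : inner ℝ (γ⁻¹ • (z - p)) h = -γ⁻¹ * inner ℝ (p - z) h := by
    rw [← neg_sub p z, smul_neg, inner_neg_left, real_inner_smul_left]; ring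
  simp only [he, hs, norm_add_sq_real, norm_smul, mul_pow, real_inner_smul_right,
    Real.norm_eq_abs, sq_abs]
  apply le_of_eq
  field_simp
  ring

lemma isProx_of_mem_subdifferential {γ : ℝ} (hγ : 0 < γ) {d : H → EReal} (hbot : ∀ x, d x ≠ ⊥)
    {p s : H} (hs : s ∈ subdifferential d p) : IsProx γ d (p + γ • s) p := by
  intro y _
  change d p + ((1 / (2 * γ) * ‖p - (p + γ • s)‖ ^ 2 : ℝ) : EReal)
    ≤ d y + ((1 / (2 * γ) * ‖y - (p + γ • s)‖ ^ 2 : ℝ) : EReal)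
  by_cases hy : d y = ⊤
  · rw [hy, EReal.top_add_coe]; exact le_top
  obtain ⟨r, hr⟩ := exists_real_eq (hbot p) hs.1
  obtain ⟨t, ht⟩ := exists_real_eq (hbot y) hy
  have h1 := le_of_mem_subdifferential hs hr ht
  rw [hr, ht]
  suffices h : r + 1 / (2 * γ) * ‖p - (p + γ • s)‖ ^ 2
      ≤ t + 1 / (2 * γ) * ‖y - (p + γ • s)‖ ^ 2 by exact_mod_cast h
  have e1 : p - (p + γ • s) = -(γ • s) := by abel
  have e2 : y - (p + γ • s) = (y - p) - γ • s := by abel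
  have e3 : 1 / (2 * γ) * ‖y - (p + γ • s)‖ ^ 2 = 1 / (2 * γ) * ‖y - p‖ ^ 2
      - inner ℝ s (y - p) + 1 / (2 * γ) * ‖γ • s‖ ^ 2 := by
    rw [e2, norm_sub_sq_real, real_inner_smul_right, real_inner_comm]
    field_simp
  have e4 : 0 ≤ 1 / (2 * γ) * ‖y - p‖ ^ 2 := by positivity
  rw [e3, e1, norm_neg]
  linarith

/-- Subgradients of a `σ`-strongly convex function are `σ`-strongly monotone. -/
lemma StronglyConvex.le_inner_sub {σ : ℝ} {d : H → EReal} (hd : StronglyConvex σ d)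
    (hbot : ∀ x, d x ≠ ⊥) {x y u v : H} (hu : u ∈ subdifferential d x)
    (hv : v ∈ subdifferential d y) : σ * ‖x - y‖ ^ 2 ≤ inner ℝ (x - y) (u - v) := by
  have key : ∀ {x y u v : H}, u ∈ subdifferential d x → v ∈ subdifferential d y →
      ∀ {r s : ℝ}, d x = r → d y = s →
      r + inner ℝ u (y - x) + σ / 2 * ‖x - y‖ ^ 2 ≤ s := by
    intro x y u v hu hv r s hr hs
    refine le_of_forall_le_add_mul (c := σ / 2 * ‖x - y‖ ^ 2) fun t ht0 ht1 => ?_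
    have h1 := hd x y (1 - t) t (by linarith) ht0 (by ring)
    have h2 := hu.2 ((1 - t) • x + t • y)
    have he : (1 - t) • x + t • y - x = t • (y - x) := by module
    rw [he, real_inner_smul_right, hr] at h2
    rw [hr, hs] at h1
    have h3 := (add_le_add_left h2 _).trans h1
    have h4 : r + t * inner ℝ u (y - x) + σ / 2 * (1 - t) * t * ‖x - y‖ ^ 2
        ≤ (1 - t) * r + t * s := by exact_mod_cast h3
    have h6 : t * (r + inner ℝ u (y - x) + σ / 2 * ‖x - y‖ ^ 2)
        ≤ t * (s + t * (σ / 2 * ‖x - y‖ ^ 2)) := by linarith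
    exact le_of_mul_le_mul_left h6 ht0
  obtain ⟨r, hr⟩ := exists_real_eq (hbot x) hu.1
  obtain ⟨s, hs⟩ := exists_real_eq (hbot y) hv.1
  have h1 := key hu hv hr hs
  have h2 := key hv hu hs hr
  rw [norm_sub_rev] at h2
  have h3 : inner ℝ (x - y) (u - v) = - inner ℝ u (y - x) - inner ℝ v (x - y) := by
    rw [inner_sub_right, real_inner_comm, real_inner_comm v, ← neg_sub x y, inner_neg_right]
    ring
  rw [h3]
  linarith

/-- `L`-smoothness of a function with values in `(-∞, ∞]`, stated without derivatives: the
convexity inequality fails by at most the amount by which it fails for `-(L / 2) ‖·‖²`. -/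
def ConvexlySmooth (L : ℝ) (d : H → EReal) : Prop :=
  ∀ (x y : H) (a b : ℝ), 0 < a → 0 < b → a + b = 1 →
    (a : EReal) * d x + (b : EReal) * d y
      ≤ d (a • x + b • y) + ((L / 2 * a * b * ‖x - y‖ ^ 2 : ℝ) : EReal)

/-- The descent lemma. The supporting affine function at `x` bounds `d` from below at a point
slightly behind `x` on the line from `y`, and smoothness turns this into an upper bound at `y`. -/
lemma ConvexlySmooth.le_of_mem_subdifferential {L : ℝ} {d : H → EReal} (hd : ConvexlySmooth L d)
    {x u : H} (hu : u ∈ subdifferential d x) {r : ℝ} (hr : d x = r) (h : H) :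
    d (x + h) ≤ ((r + inner ℝ u h + L / 2 * ‖h‖ ^ 2 : ℝ) : EReal) := by
  have step : ∀ t : ℝ, 0 < t →
      ((t / (1 + t) : ℝ) : EReal) * d (x + h) + ((1 / (1 + t) : ℝ) : EReal) * d (x - t • h)
        ≤ ((r + L / 2 * t * ‖h‖ ^ 2 : ℝ) : EReal) := by
    intro t ht
    have ht' : 1 + t ≠ 0 := by positivity
    have h1 := hd (x + h) (x - t • h) (t / (1 + t)) (1 / (1 + t)) (by positivity)
      (by positivity) (by field_simp; ring)
    have e1 : (t / (1 + t)) • (x + h) + (1 / (1 + t)) • (x - t • h) = x := by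
      have : (t / (1 + t)) • (x + h) + (1 / (1 + t)) • (x - t • h)
        = (t / (1 + t) + 1 / (1 + t)) • x + (t / (1 + t) - 1 / (1 + t) * t) • h := by module
      rw [this, ← add_div, add_comm t 1, div_self ht', one_smul]
      have : t / (1 + t) - 1 / (1 + t) * t = 0 := by field_simp; ring
      rw [this, zero_smul, add_zero]
    have e2 : x + h - (x - t • h) = (1 + t) • h := by module
    rw [e1, e2, hr, norm_smul, mul_pow, Real.norm_eq_abs, sq_abs] at h1
    convert h1 using 1
    have : L / 2 * (t / (1 + t)) * (1 / (1 + t)) * ((1 + t) ^ 2 * ‖h‖ ^ 2)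
        = L / 2 * t * ‖h‖ ^ 2 := by field_simp
    rw [this]
    norm_cast
  have lower : ∀ t : ℝ, ((r - t * inner ℝ u h : ℝ) : EReal) ≤ d (x - t • h) := by
    intro t
    have h1 := hu.2 (x - t • h)
    have e : x - t • h - x = -(t • h) := by abel
    rw [e, inner_neg_right, real_inner_smul_right, hr] at h1
    exact_mod_cast h1
  have main : ∀ t : ℝ, 0 < t → ∀ s : ℝ, (s : EReal) ≤ d (x + h) →
      s ≤ r + inner ℝ u h + L / 2 * ‖h‖ ^ 2 + t * (L / 2 * ‖h‖ ^ 2) := by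
    intro t ht s hs
    have ht' : 1 + t ≠ 0 := by positivity
    have h1 := (add_le_add
      (mul_le_mul_of_nonneg_left hs
        (by exact_mod_cast (by positivity : (0 : ℝ) ≤ t / (1 + t))))
      (mul_le_mul_of_nonneg_left (lower t)
        (by exact_mod_cast (by positivity : (0 : ℝ) ≤ 1 / (1 + t))))).trans (step t ht)
    have h2 : t / (1 + t) * s + 1 / (1 + t) * (r - t * inner ℝ u h)
        ≤ r + L / 2 * t * ‖h‖ ^ 2 := by exact_mod_cast h1
    have h3 := mul_le_mul_of_nonneg_left h2 (by positivity : (0 : ℝ) ≤ 1 + t)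
    have h4 : (1 + t) * (t / (1 + t) * s + 1 / (1 + t) * (r - t * inner ℝ u h))
        = t * s + (r - t * inner ℝ u h) := by field_simp
    rw [h4] at h3
    refine le_of_mul_le_mul_left ?_ ht
    linarith
  refine EReal.ge_of_forall_gt_iff_ge.1 fun s hs => ?_
  exact_mod_cast le_of_forall_le_add_mul fun t ht _ => main t ht s hs.le

/-- The Baillon–Haddad inequality: subgradients of an `L`-smooth function are
`(1 / L)`-cocoercive. -/
lemma ConvexlySmooth.norm_sq_le_inner_sub {L : ℝ} (hL : 0 < L) {d : H → EReal}
    (hd : ConvexlySmooth L d) (hbot : ∀ x, d x ≠ ⊥) {x y u v : H}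
    (hu : u ∈ subdifferential d x) (hv : v ∈ subdifferential d y) :
    1 / L * ‖u - v‖ ^ 2 ≤ inner ℝ (x - y) (u - v) := by
  have key : ∀ {x y u v : H}, u ∈ subdifferential d x → v ∈ subdifferential d y →
      ∀ {r s : ℝ}, d x = r → d y = s →
      s + inner ℝ v (x - y) + 1 / (2 * L) * ‖u - v‖ ^ 2 ≤ r := by
    intro x y u v hu hv r s hr hs
    -- compare the quadratic upper bound at `x` with the affine lower bound at `y` in the point
    -- where their difference is smallest
    have h1 := hd.le_of_mem_subdifferential hu hr (-(L⁻¹ • (u - v)))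
    have h2 := (hv.2 (x + -(L⁻¹ • (u - v)))).trans h1
    have e : x + -(L⁻¹ • (u - v)) - y = (x - y) - L⁻¹ • (u - v) := by abel
    rw [e, hs, inner_sub_right, inner_neg_right, norm_neg, norm_smul, mul_pow,
      real_inner_smul_right, real_inner_smul_right, Real.norm_eq_abs, sq_abs] at h2
    have h3 : s + (inner ℝ v (x - y) - L⁻¹ * inner ℝ v (u - v))
        ≤ r + -(L⁻¹ * inner ℝ u (u - v)) + L / 2 * (L⁻¹ ^ 2 * ‖u - v‖ ^ 2) := by
      exact_mod_cast h2
    have h4 : ‖u - v‖ ^ 2 = inner ℝ u (u - v) - inner ℝ v (u - v) := by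
      rw [← inner_sub_left, real_inner_self_eq_norm_sq]
    have h5 : L / 2 * (L⁻¹ ^ 2 * ‖u - v‖ ^ 2) = 1 / (2 * L) * ‖u - v‖ ^ 2 := by field_simp
    have h6 : 1 / (2 * L) * ‖u - v‖ ^ 2 + 1 / (2 * L) * ‖u - v‖ ^ 2
        = L⁻¹ * inner ℝ u (u - v) - L⁻¹ * inner ℝ v (u - v) := by
      rw [← mul_sub, ← h4]; field_simp; ring
    linarith
  obtain ⟨r, hr⟩ := exists_real_eq (hbot x) hu.1
  obtain ⟨s, hs⟩ := exists_real_eq (hbot y) hv.1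
  have h1 := key hu hv hr hs
  have h2 := key hv hu hs hr
  rw [norm_sub_rev] at h2
  have h3 : inner ℝ (x - y) (u - v) = - inner ℝ u (y - x) - inner ℝ v (x - y) := by
    rw [inner_sub_right, real_inner_comm, real_inner_comm v, ← neg_sub x y, inner_neg_right]
    ring
  have h4 : 1 / L * ‖u - v‖ ^ 2 = 2 * (1 / (2 * L) * ‖u - v‖ ^ 2) := by field_simp
  rw [h3, h4]
  linarith

lemma ConvexlySmooth.norm_sub_le {L : ℝ} (hL : 0 < L) {d : H → EReal}
    (hd : ConvexlySmooth L d) (hbot : ∀ x, d x ≠ ⊥) {x y u v : H}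
    (hu : u ∈ subdifferential d x) (hv : v ∈ subdifferential d y) :
    ‖u - v‖ ≤ L * ‖x - y‖ := by
  have h1 := (hd.norm_sq_le_inner_sub hL hbot hu hv).trans (real_inner_le_norm _ _)
  rcases (norm_nonneg (u - v)).eq_or_lt with h0 | h0
  · rw [← h0]; positivity
  · have h2 : ‖u - v‖ ^ 2 ≤ L * (‖x - y‖ * ‖u - v‖) := by
      calc ‖u - v‖ ^ 2 = L * (1 / L * ‖u - v‖ ^ 2) := by field_simp
        _ ≤ _ := by gcongr
    nlinarith

end Subgradient

/-! ### Conjugates -/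

section Conjugate

variable {H : Type*} [NormedAddCommGroup H] [InnerProductSpace ℝ H]

lemma conjugate_ne_bot {f : H → EReal} (hbot : ∀ x, f x ≠ ⊥) (htop : ∃ x, f x ≠ ⊤) (u : H) :
    conjugate f u ≠ ⊥ := by
  obtain ⟨x, hx⟩ := htop
  obtain ⟨r, hr⟩ := exists_real_eq (hbot x) hx
  have h : ((inner ℝ u x : ℝ) : EReal) - f x ≤ conjugate f u :=
    le_iSup (fun x => ((inner ℝ u x : ℝ) : EReal) - f x) x
  rw [hr] at h
  intro h'
  rw [h', le_bot_iff] at h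
  exact absurd h (EReal.coe_ne_bot (inner ℝ u x - r))

lemma le_conjugate {f : H → EReal} {x u : H} {r : ℝ} (hr : f x = r) :
    ((inner ℝ u x - r : ℝ) : EReal) ≤ conjugate f u := by
  have h : ((inner ℝ u x : ℝ) : EReal) - f x ≤ conjugate f u :=
    le_iSup (fun x => ((inner ℝ u x : ℝ) : EReal) - f x) x
  rw [hr] at h
  exact_mod_cast h

lemma conjugate_le {f : H → EReal} (hbot : ∀ x, f x ≠ ⊥) {u : H} {c : EReal}
    (h : ∀ (x : H) (r : ℝ), f x = r → ((inner ℝ u x - r : ℝ) : EReal) ≤ c) :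
    conjugate f u ≤ c := by
  refine iSup_le fun x => ?_
  by_cases hx : f x = ⊤
  · rw [hx]; simp
  · obtain ⟨r, hr⟩ := exists_real_eq (hbot x) hx
    rw [hr]
    exact_mod_cast h x r hr

/-- The Fenchel–Young equality at a subgradient. -/
lemma conjugate_eq_of_mem_subdifferential {f : H → EReal} (hbot : ∀ x, f x ≠ ⊥) {x u : H}
    (hu : u ∈ subdifferential f x) {r : ℝ} (hr : f x = r) :
    conjugate f u = ((inner ℝ u x - r : ℝ) : EReal) := by
  refine le_antisymm (conjugate_le hbot fun y s hs => ?_) (le_conjugate hr)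
  have h := le_of_mem_subdifferential hu hr hs
  rw [inner_sub_right] at h
  exact_mod_cast (by linarith : inner ℝ u y - s ≤ inner ℝ u x - r)

/-- The descent lemma for a function with `K`-Lipschitz gradient. -/
lemma le_add_inner_add_of_lipschitz_gradient [CompleteSpace H] {F : H → ℝ} {F' : H → H} {K : ℝ}
    (hF : ∀ x, HasGradientAt F (F' x) x) (hK : ∀ x y, ‖F' x - F' y‖ ≤ K * ‖x - y‖) (x h : H) :
    F (x + h) ≤ F x + inner ℝ (F' x) h + K / 2 * ‖h‖ ^ 2 := by
  have hder : ∀ t : ℝ, HasDerivAt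
      (fun t : ℝ => F (x + t • h) - t * inner ℝ (F' x) h - K / 2 * ‖h‖ ^ 2 * t ^ 2)
      (inner ℝ (F' (x + t • h)) h - inner ℝ (F' x) h - K / 2 * ‖h‖ ^ 2 * (2 * t)) t := by
    intro t
    have h1 : HasDerivAt (fun t : ℝ => x + t • h) h t := by
      simpa using ((hasDerivAt_id t).smul_const h).const_add x
    have h2 := (hF (x + t • h)).hasFDerivAt.comp_hasDerivAt t h1
    rw [InnerProductSpace.toDual_apply_apply] at h2
    have h3 : HasDerivAt (fun t : ℝ => t * inner ℝ (F' x) h) (inner ℝ (F' x) h) t := by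
      simpa using (hasDerivAt_id t).mul_const (inner ℝ (F' x) h)
    have h4 : HasDerivAt (fun t : ℝ => K / 2 * ‖h‖ ^ 2 * t ^ 2) (K / 2 * ‖h‖ ^ 2 * (2 * t)) t := by
      simpa using (hasDerivAt_pow 2 t).const_mul (K / 2 * ‖h‖ ^ 2)
    exact (h2.sub h3).sub h4
  have hanti := antitoneOn_of_deriv_nonpos (convex_Icc (0 : ℝ) 1)
    (fun t _ => (hder t).continuousAt.continuousWithinAt)
    (fun t _ => (hder t).differentiableAt.differentiableWithinAt) (fun t ht => by
      rw [interior_Icc] at ht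
      rw [(hder t).deriv, ← inner_sub_left]
      have h1 := real_inner_le_norm (F' (x + t • h) - F' x) h
      have h2 := hK (x + t • h) x
      rw [add_sub_cancel_left, norm_smul, Real.norm_eq_abs, abs_of_pos ht.1] at h2
      have h3 := mul_le_mul_of_nonneg_right h2 (norm_nonneg h)
      nlinarith)
  have := hanti (Set.left_mem_Icc.2 zero_le_one) (Set.right_mem_Icc.2 zero_le_one) zero_le_one
  simp only [one_smul, zero_smul, add_zero] at this
  linarith

/-- Smoothness of `f` makes its conjugate strongly convex. For `β = 0` this is the convexity of a
conjugate. -/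
lemma stronglyConvex_conjugate [CompleteSpace H] {β : ℝ} (hβ : 0 ≤ β) {f : H → EReal}
    (hbot : ∀ x, f x ≠ ⊥) (htop : ∃ x, f x ≠ ⊤) (hf : LipschitzGradient β f) :
    StronglyConvex β (conjugate f) := by
  intro u v a b ha hb hab
  refine le_convexCombination ha hb (conjugate_ne_bot hbot htop u) (conjugate_ne_bot hbot htop v)
    fun p q hp hq => ?_
  suffices h : conjugate f (a • u + b • v)
      ≤ ((a * p + b * q - β / 2 * a * b * ‖u - v‖ ^ 2 : ℝ) : EReal) by
    have h' := add_le_add_left h ((β / 2 * a * b * ‖u - v‖ ^ 2 : ℝ) : EReal)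
    rw [← EReal.coe_add, sub_add_cancel] at h'
    exact h'
  refine conjugate_le hbot fun x r hr => ?_
  rw [EReal.coe_le_coe_iff, inner_add_left, real_inner_smul_left, real_inner_smul_left]
  rcases hβ.eq_or_lt with h0 | h0
  · have h1 := le_conjugate (u := u) hr
    have h2 := le_conjugate (u := v) hr
    rw [hp, EReal.coe_le_coe_iff] at h1
    rw [hq, EReal.coe_le_coe_iff] at h2
    have h3 : a * r + b * r = r := by rw [← add_mul, hab, one_mul]
    rw [← h0]
    nlinarith
  · obtain ⟨F, F', hfF, hF, hK⟩ := hf h0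
    have hrF : F x = r := by
      have := (hfF x).symm.trans hr
      exact_mod_cast this
    -- the two test points have `x` as their convex combination, so the gradient terms cancel, and
    -- their distance `β ‖u - v‖` is the best one
    have h1 := le_conjugate (u := u) (hfF (x + (b * β) • (u - v)))
    have h2 := le_conjugate (u := v) (hfF (x + (-(a * β)) • (u - v)))
    rw [hp, EReal.coe_le_coe_iff, inner_add_right, real_inner_smul_right] at h1
    rw [hq, EReal.coe_le_coe_iff, inner_add_right, real_inner_smul_right] at h2
    have g1 := le_add_inner_add_of_lipschitz_gradient hF hK x ((b * β) • (u - v))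
    have g2 := le_add_inner_add_of_lipschitz_gradient hF hK x ((-(a * β)) • (u - v))
    rw [hrF, real_inner_smul_right, norm_smul, mul_pow, Real.norm_eq_abs, sq_abs] at g1 g2
    have hn : ‖u - v‖ ^ 2 = inner ℝ u (u - v) - inner ℝ v (u - v) := by
      rw [← inner_sub_left, real_inner_self_eq_norm_sq]
    have e1 : 1 / β / 2 * ((b * β) ^ 2 * ‖u - v‖ ^ 2) = b ^ 2 * (β / 2 * ‖u - v‖ ^ 2) := by
      field_simp
    have e2 : 1 / β / 2 * ((-(a * β)) ^ 2 * ‖u - v‖ ^ 2) = a ^ 2 * (β / 2 * ‖u - v‖ ^ 2) := by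
      field_simp
    rw [e1] at g1
    rw [e2] at g2
    have i1 := mul_le_mul_of_nonneg_left (add_le_add h1 g1) ha.le
    have i2 := mul_le_mul_of_nonneg_left (add_le_add h2 g2) hb.le
    obtain rfl : b = 1 - a := by linarith
    rw [hn] at i1 i2 ⊢
    linarith

/-- Strong convexity of `f` makes its conjugate smooth. -/
lemma convexlySmooth_conjugate {μ : ℝ} (hμ : 0 < μ) {f : H → EReal} (hbot : ∀ x, f x ≠ ⊥)
    (htop : ∃ x, f x ≠ ⊤) (hf : StronglyConvex μ f) : ConvexlySmooth (1 / μ) (conjugate f) := by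
  intro u v a b ha hb hab
  have hnb := conjugate_ne_bot hbot htop
  by_cases hc : conjugate f (a • u + b • v) = ⊤
  · rw [hc, EReal.top_add_coe]; exact le_top
  obtain ⟨c, hc⟩ := exists_real_eq (hnb (a • u + b • v)) hc
  have key : ∀ (x y : H) (r s : ℝ), f x = r → f y = s →
      a * (inner ℝ u x - r) + b * (inner ℝ v y - s)
        ≤ c + 1 / μ / 2 * a * b * ‖u - v‖ ^ 2 := by
    intro x y r s hr hs
    have h1 := hf x y a b ha hb hab
    rw [hr, hs] at h1
    have ht : f (a • x + b • y) ≠ ⊤ := by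
      intro ht
      rw [ht, EReal.top_add_coe, top_le_iff] at h1
      exact absurd h1 (EReal.coe_ne_top (a * r + b * s))
    obtain ⟨t, ht⟩ := exists_real_eq (hbot _) ht
    have h2 := le_conjugate (u := a • u + b • v) ht
    rw [hc, EReal.coe_le_coe_iff] at h2
    rw [ht] at h1
    have h1' : t + μ / 2 * a * b * ‖x - y‖ ^ 2 ≤ a * r + b * s := by exact_mod_cast h1
    have h3 : inner ℝ (u - v) (x - y) ≤ μ / 2 * ‖x - y‖ ^ 2 + 1 / μ / 2 * ‖u - v‖ ^ 2 := by
      have h4 := real_inner_le_norm (u - v) (x - y)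
      have h5 : 0 ≤ 1 / μ / 2 * (‖u - v‖ - μ * ‖x - y‖) ^ 2 := by positivity
      have h6 : 1 / μ / 2 * (‖u - v‖ - μ * ‖x - y‖) ^ 2
          = 1 / μ / 2 * ‖u - v‖ ^ 2 - ‖u - v‖ * ‖x - y‖ + μ / 2 * ‖x - y‖ ^ 2 := by
        field_simp
        ring
      linarith
    have h7 := mul_le_mul_of_nonneg_left h3 (mul_pos ha hb).le
    obtain rfl : b = 1 - a := by linarith
    simp only [inner_add_left, inner_add_right, inner_sub_left, inner_sub_right,
      real_inner_smul_left, real_inner_smul_right] at h2 h7 ⊢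
    linarith
  rw [hc]
  -- taking suprema one at a time also shows that both conjugates are finite
  have half : ∀ (y : H) (s : ℝ), f y = s → conjugate f u
      ≤ (((c + 1 / μ / 2 * a * b * ‖u - v‖ ^ 2 - b * (inner ℝ v y - s)) / a : ℝ) : EReal) := by
    intro y s hs
    refine conjugate_le hbot fun x r hr => ?_
    rw [EReal.coe_le_coe_iff, le_div_iff₀ ha]
    linarith [key x y r s hr hs]
  obtain ⟨y₀, hy₀⟩ := htop
  obtain ⟨s₀, hs₀⟩ := exists_real_eq (hbot y₀) hy₀
  obtain ⟨p, hp⟩ := exists_real_eq (hnb u)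
    (fun h => by have := half y₀ s₀ hs₀; rw [h, top_le_iff] at this
                 exact EReal.coe_ne_top _ this)
  have half' : conjugate f v
      ≤ (((c + 1 / μ / 2 * a * b * ‖u - v‖ ^ 2 - a * p) / b : ℝ) : EReal) := by
    refine conjugate_le hbot fun y s hs => ?_
    have h := half y s hs
    rw [hp, EReal.coe_le_coe_iff, le_div_iff₀ ha] at h
    rw [EReal.coe_le_coe_iff, le_div_iff₀ hb]
    linarith
  obtain ⟨q, hq⟩ := exists_real_eq (hnb v)
    (fun h => by rw [h, top_le_iff] at half'; exact EReal.coe_ne_top _ half')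
  rw [hq, EReal.coe_le_coe_iff, le_div_iff₀ hb] at half'
  rw [hp, hq]
  exact_mod_cast (by linarith : a * p + b * q ≤ c + 1 / μ / 2 * a * b * ‖u - v‖ ^ 2)

end Conjugate

/-! ### The dual functions -/

section Dual

variable {H G : Type*}
  [NormedAddCommGroup H] [InnerProductSpace ℝ H] [CompleteSpace H]
  [NormedAddCommGroup G] [InnerProductSpace ℝ G] [CompleteSpace G]

lemma dualF_eq_dualG (f : H → EReal) (A : H →L[ℝ] G) : dualF f A = dualG f A 0 := by
  funext w
  simp [dualF, dualG]

lemma dualG_ne_bot {g : H → EReal} (hbot : ∀ x, g x ≠ ⊥) (htop : ∃ x, g x ≠ ⊤) (B : H →L[ℝ] G)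
    (b w : G) : dualG g B b w ≠ ⊥ := by
  have h := conjugate_ne_bot hbot htop (B.adjoint w)
  unfold dualG
  by_cases ht : conjugate g (B.adjoint w) = ⊤
  · rw [ht, EReal.top_sub_coe]; simp
  · obtain ⟨r, hr⟩ := exists_real_eq h ht
    rw [hr]
    exact EReal.coe_ne_bot (r - inner ℝ w b)

lemma conjugate_eq_of_dualG_eq {g : H → EReal} {B : H →L[ℝ] G} {b w : G} {r : ℝ}
    (h : dualG g B b w = r) :
    conjugate g (B.adjoint w) = ((r + inner ℝ w b : ℝ) : EReal) := by
  unfold dualG at h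
  generalize conjugate g (B.adjoint w) = X at h ⊢
  induction X with
  | bot => simp at h
  | top => simp at h
  | coe x =>
    have : x - inner ℝ w b = r := by exact_mod_cast h
    rw [← this]; simp

lemma dualG_eq_of_conjugate_eq {g : H → EReal} {B : H →L[ℝ] G} {b w : G} {r : ℝ}
    (h : conjugate g (B.adjoint w) = r) : dualG g B b w = ((r - inner ℝ w b : ℝ) : EReal) := by
  unfold dualG
  rw [h]
  norm_cast

lemma StronglyConvex.dualG {σ α : ℝ} (hσ : 0 ≤ σ) {g : H → EReal} (hbot : ∀ x, g x ≠ ⊥)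
    (htop : ∃ x, g x ≠ ⊤) {B : H →L[ℝ] G} (hB : StronglyMonotone α (B ∘L B.adjoint)) (b : G)
    (h : StronglyConvex σ (conjugate g)) : StronglyConvex (σ * α) (dualG g B b) := by
  intro u v a c ha hc hac
  refine le_convexCombination ha hc (dualG_ne_bot hbot htop B b u) (dualG_ne_bot hbot htop B b v)
    fun p q hp hq => ?_
  have h1 := h (B.adjoint u) (B.adjoint v) a c ha hc hac
  rw [conjugate_eq_of_dualG_eq hp, conjugate_eq_of_dualG_eq hq, ← map_smul, ← map_smul, ← map_add,
    ← map_sub] at h1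
  have ht : conjugate g (B.adjoint (a • u + c • v)) ≠ ⊤ := by
    intro ht
    rw [ht, EReal.top_add_coe, top_le_iff] at h1
    exact absurd h1 (EReal.coe_ne_top (a * (p + inner ℝ u b) + c * (q + inner ℝ v b)))
  obtain ⟨t, ht⟩ := exists_real_eq (conjugate_ne_bot hbot htop _) ht
  rw [ht] at h1
  rw [dualG_eq_of_conjugate_eq ht]
  have h1' : t + σ / 2 * a * c * ‖B.adjoint (u - v)‖ ^ 2
      ≤ a * (p + inner ℝ u b) + c * (q + inner ℝ v b) := by exact_mod_cast h1
  have h2 := hB (u - v)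
  rw [ContinuousLinearMap.comp_apply, ← ContinuousLinearMap.adjoint_inner_right,
    real_inner_self_eq_norm_sq] at h2
  have h3 := mul_le_mul_of_nonneg_left h2 (by positivity : 0 ≤ σ / 2 * a * c)
  rw [inner_add_left, real_inner_smul_left, real_inner_smul_left]
  exact_mod_cast (by linarith : t - (a * inner ℝ u b + c * inner ℝ v b)
    + σ * α / 2 * a * c * ‖u - v‖ ^ 2 ≤ a * p + c * q)

lemma ConvexlySmooth.dualG {L : ℝ} (hL : 0 ≤ L) {g : H → EReal} (hbot : ∀ x, g x ≠ ⊥)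
    (htop : ∃ x, g x ≠ ⊤) (B : H →L[ℝ] G) (b : G) (h : ConvexlySmooth L (conjugate g)) :
    ConvexlySmooth (L * ‖B‖ ^ 2) (dualG g B b) := by
  intro u v a c ha hc hac
  by_cases ht : RelaxedADMM.dualG g B b (a • u + c • v) = ⊤
  · rw [ht, EReal.top_add_coe]; exact le_top
  obtain ⟨t, ht⟩ := exists_real_eq (dualG_ne_bot hbot htop B b _) ht
  have h1 := h (B.adjoint u) (B.adjoint v) a c ha hc hac
  rw [← map_smul, ← map_smul, ← map_add, ← map_sub, conjugate_eq_of_dualG_eq ht] at h1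
  have hnb := conjugate_ne_bot hbot htop
  have fin : ∀ {X Y : EReal} {r : ℝ}, X ≠ ⊥ → Y ≠ ⊥ →
      (a : EReal) * X + (c : EReal) * Y ≤ r → (∃ x : ℝ, X = x) ∧ ∃ y : ℝ, Y = y := by
    intro X Y r hX hY hXY
    induction X with
    | bot => exact absurd rfl hX
    | top =>
      rw [EReal.coe_mul_top_of_pos ha, EReal.top_add_of_ne_bot, top_le_iff] at hXY
      · exact absurd hXY (EReal.coe_ne_top r)
      · induction Y with
        | bot => exact absurd rfl hY
        | top => rw [EReal.coe_mul_top_of_pos hc]; simp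
        | coe y => exact EReal.coe_ne_bot (c * y)
    | coe x =>
      induction Y with
      | bot => exact absurd rfl hY
      | top =>
        rw [EReal.coe_mul_top_of_pos hc, ← EReal.coe_mul, EReal.coe_add_top, top_le_iff] at hXY
        exact absurd hXY (EReal.coe_ne_top r)
      | coe y => exact ⟨⟨x, rfl⟩, ⟨y, rfl⟩⟩
  obtain ⟨⟨p, hp⟩, q, hq⟩ := fin (hnb (B.adjoint u)) (hnb (B.adjoint v))
    (h1.trans (EReal.coe_add _ _).symm.le)
  rw [hp, hq] at h1
  rw [ht, dualG_eq_of_conjugate_eq hp, dualG_eq_of_conjugate_eq hq]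
  have h1' : a * p + c * q ≤ t + inner ℝ (a • u + c • v) b
      + L / 2 * a * c * ‖B.adjoint (u - v)‖ ^ 2 := by exact_mod_cast h1
  have h2 : ‖B.adjoint (u - v)‖ ≤ ‖B‖ * ‖u - v‖ := by
    simpa using B.adjoint.le_opNorm (u - v)
  have h3 : ‖B.adjoint (u - v)‖ ^ 2 ≤ ‖B‖ ^ 2 * ‖u - v‖ ^ 2 := by
    rw [← mul_pow]; gcongr
  have h4 := mul_le_mul_of_nonneg_left h3 (by positivity : 0 ≤ L / 2 * a * c)
  rw [inner_add_left, real_inner_smul_left, real_inner_smul_left] at h1'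
  exact_mod_cast (by linarith : a * (p - inner ℝ u b) + c * (q - inner ℝ v b)
    ≤ t + L * ‖B‖ ^ 2 / 2 * a * c * ‖u - v‖ ^ 2)

/-- Optimality in a primal subproblem, read on the dual side. -/
lemma mem_subdifferential_dualG {g : H → EReal} (hbot : ∀ x, g x ≠ ⊥) {B : H →L[ℝ] G} (b : G)
    {w : G} {y : H} (hw : B.adjoint w ∈ subdifferential g y) :
    B y - b ∈ subdifferential (dualG g B b) w := by
  obtain ⟨r, hr⟩ := exists_real_eq (hbot y) hw.1
  have hD := dualG_eq_of_conjugate_eq (b := b) (conjugate_eq_of_mem_subdifferential hbot hw hr)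
  refine ⟨by rw [hD]; exact EReal.coe_ne_top _, fun v => ?_⟩
  have h := le_conjugate (u := B.adjoint v) hr
  have h' := EReal.sub_le_sub h (le_refl ((inner ℝ v b : ℝ) : EReal))
  refine le_trans (le_of_eq ?_) h'
  rw [hD, ContinuousLinearMap.adjoint_inner_left, ContinuousLinearMap.adjoint_inner_left]
  have e : inner ℝ (B y - b) (v - w)
      = inner ℝ v (B y) - inner ℝ w (B y) - inner ℝ v b + inner ℝ w b := by
    rw [real_inner_comm, inner_sub_left, inner_sub_right, inner_sub_right]; ring
  rw [e]
  have : inner ℝ w (B y) - r - inner ℝ w b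
      + (inner ℝ v (B y) - inner ℝ w (B y) - inner ℝ v b + inner ℝ w b)
      = inner ℝ v (B y) - r - inner ℝ v b := by ring
  exact_mod_cast this

/-- Fermat's rule for a subproblem of ADMM. -/
lemma adjoint_mem_subdifferential_of_isMinOn {g : H → EReal} (hg : ClosedProperConvex g)
    {B : H →L[ℝ] G} {γ : ℝ} {w c e : G} {y : H}
    (hmin : IsMinOn (fun v => g v + ((-inner ℝ w (c + B v)
      + γ / 2 * ‖c + B v + e‖ ^ 2 : ℝ) : EReal)) Set.univ y) :
    B.adjoint (w - γ • (c + B y + e)) ∈ subdifferential g y := by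
  refine mem_subdifferential_of_isMinOn_add hg.ne_bot hg.exists_ne_top hg.convex
    (q := fun v => -inner ℝ w (c + B v) + γ / 2 * ‖c + B v + e‖ ^ 2) hmin
    fun h => ⟨γ / 2 * ‖B h‖ ^ 2, fun t => ?_⟩
  have e1 : c + (B y + t • B h) + e = (c + B y + e) + t • B h := by abel
  have e2 : c + (B y + t • B h) = (c + B y) + t • B h := by abel
  simp only [map_add]
  rw [map_smul B t h, ContinuousLinearMap.adjoint_inner_left, e1, e2, norm_add_sq_real,
    norm_smul, mul_pow, Real.norm_eq_abs, sq_abs, inner_sub_left, real_inner_smul_left,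
    real_inner_smul_right, inner_add_right w, real_inner_smul_right]
  apply le_of_eq
  ring

end Dual

/-! ### Relaxed ADMM as relaxed Peaceman–Rachford splitting of the dual problem -/

section Splitting

variable {H₁ H₂ G : Type*}
  [NormedAddCommGroup H₁] [InnerProductSpace ℝ H₁] [CompleteSpace H₁]
  [NormedAddCommGroup H₂] [InnerProductSpace ℝ H₂] [CompleteSpace H₂]
  [NormedAddCommGroup G] [InnerProductSpace ℝ G] [CompleteSpace G]

lemma IsRelaxedADMM.isRelaxedPRS {γ : ℝ} (hγ : 0 < γ) {lam : ℕ → ℝ} {f : H₁ → EReal}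
    {g : H₂ → EReal} (hf : ClosedProperConvex f) (hg : ClosedProperConvex g)
    {A : H₁ →L[ℝ] G} {B : H₂ →L[ℝ] G} {b : G} {x : ℕ → H₁} {y : ℕ → H₂} {w z : ℕ → G}
    (h : IsRelaxedADMM γ lam f g A B b x y w z) :
    IsRelaxedPRS γ lam (dualF f A) (dualG g B b) z := by
  have hz : ∀ k, z k = w (k + 1) + γ • (B (y (k + 1)) - b) := by
    intro k
    induction k with
    | zero =>
      rw [h.z_init, h.w_step 0, h.x_init, shiftedRelaxation, map_zero]
      module
    | succ k ih =>
      rw [h.z_step k, ih, h.w_step (k + 1), shiftedRelaxation]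
      module
  intro k
  set v : G := w (k + 1) - γ • (A (x (k + 1)) + B (y (k + 1)) - b) with hv
  have hg' : B (y (k + 1)) - b ∈ subdifferential (dualG g B b) (w (k + 1)) := by
    apply mem_subdifferential_dualG hg.ne_bot
    have hmin := h.y_step k
    have := adjoint_mem_subdifferential_of_isMinOn hg (w := w k) (γ := γ) (c := A (x k) - b)
      (e := (2 * shiftedRelaxation lam k - 1) • (A (x k) + B (y k) - b)) (B := B)
      (y := y (k + 1)) (by
        convert hmin using 5 <;> congr 3 <;> abel_nf)
    convert this using 2
    rw [h.w_step k]
    module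
  have hf' : A (x (k + 1)) ∈ subdifferential (dualF f A) v := by
    rw [dualF_eq_dualG]
    have hmin := h.x_step k
    have := adjoint_mem_subdifferential_of_isMinOn hf (w := w (k + 1)) (γ := γ)
      (c := B (y (k + 1)) - b) (e := 0) (B := A) (y := x (k + 1)) (by
        convert hmin using 5 <;> congr 3 <;> abel_nf)
    have hsub : A.adjoint v ∈ subdifferential f (x (k + 1)) := by
      convert this using 2
      rw [hv]
      module
    simpa using mem_subdifferential_dualG hf.ne_bot 0 hsub
  refine ⟨z k - (2 * γ) • (A (x (k + 1)) + B (y (k + 1)) - b),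
    ⟨(2 : ℝ) • w (k + 1) - z k, ⟨w (k + 1), ?_, rfl⟩, ⟨v, ?_, ?_⟩⟩, ?_⟩
  · rw [hz k]
    exact isProx_of_mem_subdifferential hγ (dualG_ne_bot hg.ne_bot hg.exists_ne_top B b) hg'
  · have e : (2 : ℝ) • w (k + 1) - z k = v + γ • A (x (k + 1)) := by
      rw [hz k, hv]; module
    rw [e]
    refine isProx_of_mem_subdifferential hγ ?_ hf'
    rw [dualF_eq_dualG]
    exact dualG_ne_bot hf.ne_bot hf.exists_ne_top A 0
  · rw [hv]; module
  · rw [h.z_step k]; module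

end Splitting

/-! ### One step of relaxed Peaceman–Rachford splitting -/

section Step

lemma norm_add_add_sq_le {G : Type*} [NormedAddCommGroup G] (x y z : G) :
    ‖x + y + z‖ ^ 2 ≤ 3 * (‖x‖ ^ 2 + ‖y‖ ^ 2 + ‖z‖ ^ 2) := by
  have h : ‖x + y + z‖ ≤ ‖x‖ + ‖y‖ + ‖z‖ := norm_add₃_le
  have h' : ‖x + y + z‖ ^ 2 ≤ (‖x‖ + ‖y‖ + ‖z‖) ^ 2 := by gcongr
  nlinarith [sq_nonneg (‖x‖ - ‖y‖), sq_nonneg (‖y‖ - ‖z‖), sq_nonneg (‖x‖ - ‖z‖)]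

variable {G : Type*} [NormedAddCommGroup G] [InnerProductSpace ℝ G]

lemma norm_sub_smul_sq (γ : ℝ) (w s : G) :
    ‖w - γ • s‖ ^ 2 = ‖w + γ • s‖ ^ 2 - 4 * γ * inner ℝ w s := by
  rw [norm_sub_sq_real, norm_add_sq_real, real_inner_smul_right]
  ring

/-- Reflections contract when the operator is both strongly monotone and Lipschitz. -/
lemma norm_sub_smul_sq_le {γ σ L : ℝ} (hγ : 0 < γ) (hσ : 0 ≤ σ) (hL : 0 ≤ L) {w s : G}
    (hws : σ * ‖w‖ ^ 2 ≤ inner ℝ w s) (hs : ‖s‖ ≤ L * ‖w‖) :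
    ‖w - γ • s‖ ^ 2 ≤ (1 - 4 * γ * σ / (1 + γ * L) ^ 2) * ‖w + γ • s‖ ^ 2 := by
  have h1 : ‖w + γ • s‖ ≤ (1 + γ * L) * ‖w‖ := by
    have h2 := norm_add_le w (γ • s)
    rw [norm_smul, Real.norm_eq_abs, abs_of_pos hγ] at h2
    have h3 := mul_le_mul_of_nonneg_left hs hγ.le
    linarith
  have h2 : ‖w + γ • s‖ ^ 2 ≤ (1 + γ * L) ^ 2 * ‖w‖ ^ 2 := by
    rw [← mul_pow]; gcongr
  have hpos : 0 < (1 + γ * L) ^ 2 := by positivity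
  have h3 : 4 * γ * σ / (1 + γ * L) ^ 2 * ‖w + γ • s‖ ^ 2 ≤ 4 * γ * (σ * ‖w‖ ^ 2) := by
    calc 4 * γ * σ / (1 + γ * L) ^ 2 * ‖w + γ • s‖ ^ 2
        ≤ 4 * γ * σ / (1 + γ * L) ^ 2 * ((1 + γ * L) ^ 2 * ‖w‖ ^ 2) := by gcongr
      _ = 4 * γ * (σ * ‖w‖ ^ 2) := by field_simp
  have h4 := mul_le_mul_of_nonneg_left hws (by positivity : 0 ≤ 4 * γ)
  rw [norm_sub_smul_sq]
  linarith

lemma norm_relaxation_sq (l : ℝ) (z t : G) : ‖(1 - l) • z + l • t‖ ^ 2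
    = (1 - l) * ‖z‖ ^ 2 + l * ‖t‖ ^ 2 - l * (1 - l) * ‖z - t‖ ^ 2 := by
  rw [norm_add_sq_real, norm_sub_sq_real, norm_smul, norm_smul, mul_pow, mul_pow,
    real_inner_smul_left, real_inner_smul_right, Real.norm_eq_abs, Real.norm_eq_abs, sq_abs,
    sq_abs]
  ring

lemma norm_relaxation_sq_le {l c : ℝ} (hl0 : 0 ≤ l) (hl1 : l ≤ 1) {z t : G}
    (h : ‖t‖ ^ 2 ≤ (1 - c) * ‖z‖ ^ 2) :
    ‖(1 - l) • z + l • t‖ ^ 2 ≤ (1 - l * c) * ‖z‖ ^ 2 := by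
  have h1 := mul_le_mul_of_nonneg_left h hl0
  have h2 : 0 ≤ l * (1 - l) * ‖z - t‖ ^ 2 :=
    mul_nonneg (mul_nonneg hl0 (by linarith)) (sq_nonneg _)
  rw [norm_relaxation_sq]
  linarith

/-- The decrease in a relaxed step: the two inner products and the residual `w₁ - w₂`
add up. -/
lemma norm_relaxed_step_sq {γ l : ℝ} {w₁ s₁ w₂ s₂ : G} (h : w₂ + γ • s₂ = w₁ - γ • s₁) :
    ‖(1 - l) • (w₁ + γ • s₁) + l • (w₂ - γ • s₂)‖ ^ 2 = ‖w₁ + γ • s₁‖ ^ 2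
      - 4 * l * (γ * inner ℝ w₁ s₁ + γ * inner ℝ w₂ s₂ + (1 - l) * ‖w₁ - w₂‖ ^ 2) := by
  have e : w₁ + γ • s₁ - (w₂ - γ • s₂) = (2 : ℝ) • (w₁ - w₂) := by
    have : γ • s₂ = w₁ - γ • s₁ - w₂ := by rw [← h]; abel
    rw [this]; module
  rw [norm_relaxation_sq, e, norm_sub_smul_sq γ w₂ s₂, h, norm_sub_smul_sq γ w₁ s₁, norm_smul,
    mul_pow]
  norm_num
  ring

/-- The decrease in `norm_relaxed_step_sq` controls `p`, `q` and the residual `w₁ - w₂`, each with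
weight at least `m`. As their sum is the initial error, `‖a + b + c‖² ≤ 3 (‖a‖² + ‖b‖² + ‖c‖²)`
turns it into a rate. -/
lemma norm_relaxed_step_sq_le_of_split {γ l m : ℝ} (hl0 : 0 ≤ l) {w₁ s₁ w₂ s₂ p q : G}
    (h : w₂ + γ • s₂ = w₁ - γ • s₁) (hm0 : 0 ≤ m) (hm : m ≤ 1 - l)
    (hz : w₁ + γ • s₁ = p + q + (w₁ - w₂))
    (hpq : m * (‖p‖ ^ 2 + ‖q‖ ^ 2) ≤ γ * inner ℝ w₁ s₁ + γ * inner ℝ w₂ s₂) :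
    ‖(1 - l) • (w₁ + γ • s₁) + l • (w₂ - γ • s₂)‖ ^ 2
      ≤ (1 - 4 * l * m / 3) * ‖w₁ + γ • s₁‖ ^ 2 := by
  have h1 := norm_add_add_sq_le p q (w₁ - w₂)
  rw [← hz] at h1
  have h2 := mul_le_mul_of_nonneg_right hm (sq_nonneg ‖w₁ - w₂‖)
  have h3 : m * ‖w₁ + γ • s₁‖ ^ 2
      ≤ 3 * (γ * inner ℝ w₁ s₁ + γ * inner ℝ w₂ s₂ + (1 - l) * ‖w₁ - w₂‖ ^ 2) := by
    have := mul_le_mul_of_nonneg_left h1 hm0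
    linarith
  have h4 := mul_le_mul_of_nonneg_left h3 hl0
  rw [norm_relaxed_step_sq h]
  linarith

/-- `(w, s)` is the difference of two points in the graph of the subdifferential of `d`. -/
def IsSubgradientDifference (d : G → EReal) (w s : G) : Prop :=
  ∃ x y u v, u ∈ subdifferential d x ∧ v ∈ subdifferential d y ∧ w = x - y ∧ s = u - v

lemma IsSubgradientDifference.le_inner {d : G → EReal} {w s : G}
    (h : IsSubgradientDifference d w s) {σ : ℝ} (hd : StronglyConvex σ d) (hbot : ∀ x, d x ≠ ⊥) :
    σ * ‖w‖ ^ 2 ≤ inner ℝ w s := by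
  obtain ⟨x, y, u, v, hu, hv, rfl, rfl⟩ := h
  exact hd.le_inner_sub hbot hu hv

lemma IsSubgradientDifference.norm_sq_le_inner {d : G → EReal} {w s : G}
    (h : IsSubgradientDifference d w s) {L : ℝ} (hL : 0 < L) (hd : ConvexlySmooth L d)
    (hbot : ∀ x, d x ≠ ⊥) : 1 / L * ‖s‖ ^ 2 ≤ inner ℝ w s := by
  obtain ⟨x, y, u, v, hu, hv, rfl, rfl⟩ := h
  exact hd.norm_sq_le_inner_sub hL hbot hu hv

lemma IsSubgradientDifference.norm_le {d : G → EReal} {w s : G}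
    (h : IsSubgradientDifference d w s) {L : ℝ} (hL : 0 < L) (hd : ConvexlySmooth L d)
    (hbot : ∀ x, d x ≠ ⊥) : ‖s‖ ≤ L * ‖w‖ := by
  obtain ⟨x, y, u, v, hu, hv, rfl, rfl⟩ := h
  exact hd.norm_sub_le hL hbot hu hv

lemma IsPRSImage.exists_subgradients {γ : ℝ} (hγ : 0 < γ) {d e : G → EReal}
    (hdbot : ∀ x, d x ≠ ⊥) (hdtop : ∃ x, d x ≠ ⊤) (hd : StronglyConvex 0 d)
    (hebot : ∀ x, e x ≠ ⊥) (hetop : ∃ x, e x ≠ ⊤) (he : StronglyConvex 0 e)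
    {z t : G} (h : IsPRSImage γ d e z t) :
    ∃ w₁ s₁ w₂ s₂ : G, s₁ ∈ subdifferential e w₁ ∧ s₂ ∈ subdifferential d w₂ ∧
      z = w₁ + γ • s₁ ∧ w₂ + γ • s₂ = w₁ - γ • s₁ ∧ t = w₂ - γ • s₂ := by
  obtain ⟨r, ⟨p, hp, rfl⟩, ⟨q, hq, rfl⟩⟩ := h
  refine ⟨p, γ⁻¹ • (z - p), q, γ⁻¹ • ((2 : ℝ) • p - z - q),
    hp.mem_subdifferential hγ hebot hetop (he.convex le_rfl),
    hq.mem_subdifferential hγ hdbot hdtop (hd.convex le_rfl), ?_, ?_, ?_⟩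
  all_goals
    simp only [smul_inv_smul₀ hγ.ne']
    module

lemma IsRelaxedPRS.exists_subgradientDifference {γ : ℝ} (hγ : 0 < γ) {lam : ℕ → ℝ}
    {d e : G → EReal}
    (hdbot : ∀ x, d x ≠ ⊥) (hdtop : ∃ x, d x ≠ ⊤) (hd : StronglyConvex 0 d)
    (hebot : ∀ x, e x ≠ ⊥) (hetop : ∃ x, e x ≠ ⊤) (he : StronglyConvex 0 e)
    {z : ℕ → G} {zs : G} (hz : IsRelaxedPRS γ lam d e z) (hzs : IsPRSImage γ d e zs zs) (k : ℕ) :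
    ∃ w₁ s₁ w₂ s₂ : G, IsSubgradientDifference e w₁ s₁ ∧ IsSubgradientDifference d w₂ s₂ ∧
      w₂ + γ • s₂ = w₁ - γ • s₁ ∧ z k - zs = w₁ + γ • s₁ ∧
      z (k + 1) - zs = (1 - lam k) • (w₁ + γ • s₁) + lam k • (w₂ - γ • s₂) := by
  obtain ⟨t, ht, hzk⟩ := hz k
  obtain ⟨w₁, s₁, w₂, s₂, h₁, h₂, e₁, e₂, e₃⟩ :=
    ht.exists_subgradients hγ hdbot hdtop hd hebot hetop he
  obtain ⟨w₁', s₁', w₂', s₂', h₁', h₂', e₁', e₂', e₃'⟩ :=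
    hzs.exists_subgradients hγ hdbot hdtop hd hebot hetop he
  have hdiff₁ : z k - zs = (w₁ - w₁') + γ • (s₁ - s₁') := by
    rw [e₁, e₁']; module
  have hdiff₂ : t - zs = (w₂ - w₂') - γ • (s₂ - s₂') := by
    rw [e₃, e₃']; module
  refine ⟨w₁ - w₁', s₁ - s₁', w₂ - w₂', s₂ - s₂', ⟨_, _, _, _, h₁, h₁', rfl, rfl⟩,
    ⟨_, _, _, _, h₂, h₂', rfl, rfl⟩, ?_, hdiff₁, ?_⟩
  · calc (w₂ - w₂') + γ • (s₂ - s₂') = (w₂ + γ • s₂) - (w₂' + γ • s₂') := by module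
      _ = (w₁ - w₁') - γ • (s₁ - s₁') := by rw [e₂, e₂']; module
  · rw [← hdiff₁, ← hdiff₂, hzk]; module

end Step

/-! ### Rates -/

section Rates

variable {G : Type*} [NormedAddCommGroup G]

/-- No sign is required of `q`: a negative `q` forces `a = 0`. -/
lemma le_sqrt_mul_of_sq_le {a c q : ℝ} (ha : 0 ≤ a) (hc : 0 ≤ c) (h : a ^ 2 ≤ q * c ^ 2) :
    a ≤ √q * c := by
  rw [← Real.sqrt_sq ha]
  refine (Real.sqrt_le_sqrt h).trans (le_of_eq ?_)
  rw [Real.sqrt_mul' q (sq_nonneg c), Real.sqrt_sq hc]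

lemma convergesLinearly_of_sq_le {z : ℕ → G} {zs : G} {q : ℕ → ℝ} {Q : ℝ} (hQ : Q < 1)
    (hqQ : ∀ k, q k ≤ Q) (h : ∀ k, ‖z (k + 1) - zs‖ ^ 2 ≤ q k * ‖z k - zs‖ ^ 2) :
    ConvergesLinearly z zs := by
  refine ⟨√Q, Real.sqrt_nonneg _, ?_, fun k => ?_⟩
  · rw [Real.sqrt_lt' one_pos]; simpa using hQ
  · refine le_sqrt_mul_of_sq_le (norm_nonneg _) (norm_nonneg _) ((h k).trans ?_)
    gcongr
    exact hqQ k

/-- A relaxation whose steps satisfy `λ_k (1 - λ_k) ≥ ε` decreases the squared distance at a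
uniform rate. -/
lemma convergesLinearly_of_sq_le_min {z : ℕ → G} {zs : G} {lam : ℕ → ℝ} {c ε : ℝ} (hc : 0 < c)
    (hlam : ∀ k, 0 < lam k ∧ lam k ≤ 1) (hε : 0 < ε) (hle : ∀ k, ε ≤ lam k * (1 - lam k))
    (h : ∀ k, ‖z (k + 1) - zs‖ ^ 2
      ≤ (1 - 4 * lam k * min c (1 - lam k) / 3) * ‖z k - zs‖ ^ 2) :
    ConvergesLinearly z zs := by
  refine convergesLinearly_of_sq_le (Q := 1 - 4 * ε * min c ε / 3) ?_ (fun k => ?_) h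
  · have : 0 < ε * min c ε := mul_pos hε (lt_min hc hε)
    linarith
  · obtain ⟨h0, h1⟩ := hlam k
    have h2 := hle k
    have h3 : ε ≤ lam k := by nlinarith
    have h4 : ε ≤ 1 - lam k := by nlinarith
    have h5 : ε * min c ε ≤ lam k * min c (1 - lam k) :=
      mul_le_mul h3 (min_le_min_left c h4) (lt_min hc hε).le h0.le
    linarith

/-- Strong monotonicity of one operator controls `w`, and cocoercivity of the other controls `s`. -/
lemma weighted_norm_sq_le {γ σ L m i j : ℝ} (hγ : 0 < γ) (hL : 0 < L) {w s : G}
    (hw : σ * ‖w‖ ^ 2 ≤ i) (hs : 1 / L * ‖s‖ ^ 2 ≤ j) (hmσ : m ≤ γ * σ)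
    (hmL : m ≤ 1 / (L * γ)) : m * (‖w‖ ^ 2 + γ ^ 2 * ‖s‖ ^ 2) ≤ γ * i + γ * j := by
  have h1 : m * ‖w‖ ^ 2 ≤ γ * i := by
    calc m * ‖w‖ ^ 2 ≤ γ * σ * ‖w‖ ^ 2 := by gcongr
      _ = γ * (σ * ‖w‖ ^ 2) := by ring
      _ ≤ γ * i := by gcongr
  have h2 : m * (γ ^ 2 * ‖s‖ ^ 2) ≤ γ * j := by
    calc m * (γ ^ 2 * ‖s‖ ^ 2) ≤ 1 / (L * γ) * (γ ^ 2 * ‖s‖ ^ 2) := by gcongr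
      _ = γ * (1 / L * ‖s‖ ^ 2) := by field_simp
      _ ≤ γ * j := by gcongr
  linarith

end Rates

end RelaxedADMM

/-! ### Linear convergence -/

open RelaxedADMM in
theorem mainTheorem10 {H₁ H₂ G : Type*}
    [NormedAddCommGroup H₁] [InnerProductSpace ℝ H₁] [CompleteSpace H₁]
    [NormedAddCommGroup H₂] [InnerProductSpace ℝ H₂] [CompleteSpace H₂]
    [NormedAddCommGroup G] [InnerProductSpace ℝ G] [CompleteSpace G]
    (f : H₁ → EReal) (g : H₂ → EReal) (A : H₁ →L[ℝ] G) (B : H₂ →L[ℝ] G) (b : G)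
    (μf μg βf βg αA αB γ : ℝ) (lam : ℕ → ℝ) (z : ℕ → G) (zs : G)
    (hf : ClosedProperConvex f) (hg : ClosedProperConvex g)
    (hμf : 0 ≤ μf) (hμg : 0 ≤ μg) (hβf : 0 ≤ βf) (hβg : 0 ≤ βg) (hαA : 0 ≤ αA) (hαB : 0 ≤ αB)
    (hfconv : StronglyConvex μf f) (hgconv : StronglyConvex μg g)
    (hflip : LipschitzGradient βf f) (hglip : LipschitzGradient βg g)
    (hA : StronglyMonotone αA (A ∘L A.adjoint)) (hB : StronglyMonotone αB (B ∘L B.adjoint))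
    (hAB : ‖A‖ * ‖B‖ ≠ 0)
    (hsol : ∃ w u, u ∈ subdifferential (dualF f A) w ∧ -u ∈ subdifferential (dualG g B b) w)
    (hγ : 0 < γ) (hlam : ∀ k, 0 < lam k ∧ lam k ≤ 1)
    (hz : IsRelaxedPRS γ lam (dualF f A) (dualG g B b) z ∨
      ∃ x y w, IsRelaxedADMM γ lam f g A B b x y w z)
    (hzs : IsPRSImage γ (dualF f A) (dualG g B b) zs zs) :
    (0 < μg * βg * αB →
      (∀ k, ‖z (k + 1) - zs‖ ≤
        √(1 - 4 * γ * lam k * βg * αB / (1 + γ * ‖B‖ ^ 2 / μg) ^ 2) * ‖z k - zs‖) ∧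
      ((∃ ε > 0, ∀ k, ε ≤ lam k) → ConvergesLinearly z zs)) ∧
    (0 < μf * βf * αA →
      (∀ k, ‖z (k + 1) - zs‖ ≤
        √(1 - lam k * min (4 * γ * βf * αA / (1 + γ * ‖A‖ ^ 2 / μf) ^ 2) (1 - lam k) / 2)
          * ‖z k - zs‖) ∧
      ((∃ ε > 0, ∀ k, ε ≤ lam k) → ConvergesLinearly z zs)) ∧
    (0 < μf * βg * αB →
      (∀ k, ‖z (k + 1) - zs‖ ≤
        √(1 - 4 * lam k * min (min (γ * βg * αB) (μf / (‖A‖ ^ 2 * γ))) (1 - lam k) / 3)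
          * ‖z k - zs‖) ∧
      ((∃ ε > 0, ∀ k, ε ≤ lam k * (1 - lam k)) → ConvergesLinearly z zs)) ∧
    (0 < μg * βf * αA →
      (∀ k, ‖z (k + 1) - zs‖ ≤
        √(1 - 4 * lam k * min (min (γ * βf * αA) (μg / (‖B‖ ^ 2 * γ))) (1 - lam k) / 3)
          * ‖z k - zs‖) ∧
      ((∃ ε > 0, ∀ k, ε ≤ lam k * (1 - lam k)) → ConvergesLinearly z zs)) := by
  rw [dualF_eq_dualG] at hsol hzs
  have hPRS : IsRelaxedPRS γ lam (dualG f A 0) (dualG g B b) z := by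
    rw [← dualF_eq_dualG]
    rcases hz with hz | ⟨x, y, w, hz⟩
    · exact hz
    · exact hz.isRelaxedPRS hγ hf hg
  have hfbot := dualG_ne_bot hf.ne_bot hf.exists_ne_top A 0
  have hgbot := dualG_ne_bot hg.ne_bot hg.exists_ne_top B b
  have hfσ := (stronglyConvex_conjugate hβf hf.ne_bot hf.exists_ne_top hflip).dualG hβf
    hf.ne_bot hf.exists_ne_top hA 0
  have hgσ := (stronglyConvex_conjugate hβg hg.ne_bot hg.exists_ne_top hglip).dualG hβg
    hg.ne_bot hg.exists_ne_top hB b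
  have hnA : 0 < ‖A‖ := (norm_nonneg A).lt_of_ne' (left_ne_zero_of_mul hAB)
  have hnB : 0 < ‖B‖ := (norm_nonneg B).lt_of_ne' (right_ne_zero_of_mul hAB)
  have hfL := fun h : 0 < μf => (convexlySmooth_conjugate h hf.ne_bot hf.exists_ne_top
    hfconv).dualG (one_div_pos.2 h).le hf.ne_bot hf.exists_ne_top A 0
  have hgL := fun h : 0 < μg => (convexlySmooth_conjugate h hg.ne_bot hg.exists_ne_top
    hgconv).dualG (one_div_pos.2 h).le hg.ne_bot hg.exists_ne_top B b
  obtain ⟨w₀, u₀, hu₀, hv₀⟩ := hsol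
  have hstep := hPRS.exists_subgradientDifference hγ hfbot ⟨w₀, hu₀.1⟩
    (hfσ.zero_of_nonneg (mul_nonneg hβf hαA)) hgbot ⟨w₀, hv₀.1⟩
    (hgσ.zero_of_nonneg (mul_nonneg hβg hαB)) hzs
  have hmono : ∀ {d : G → EReal} {σ : ℝ} {w s : G}, StronglyConvex σ d → 0 ≤ σ →
      (∀ x, d x ≠ ⊥) → IsSubgradientDifference d w s → 0 ≤ inner ℝ w s :=
    fun hd hσ hbot h => (by positivity : 0 ≤ _ * ‖_‖ ^ 2).trans (h.le_inner hd hbot)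
  have hpos : ∀ {p q r : ℝ}, 0 ≤ p → 0 ≤ q → 0 ≤ r → 0 < p * q * r → 0 < p ∧ 0 < q ∧ 0 < r := by
    intro p q r hp hq hr h
    refine ⟨hp.lt_of_ne' ?_, hq.lt_of_ne' ?_, hr.lt_of_ne' ?_⟩ <;> rintro rfl <;> simp at h
  refine ⟨fun h => ?_, fun h => ?_, fun h => ?_, fun h => ?_⟩
  · obtain ⟨h1, h2, h3⟩ := hpos hμg hβg hαB h
    have hL : 0 < 1 / μg * ‖B‖ ^ 2 := by positivity
    set c := 4 * γ * βg * αB / (1 + γ * ‖B‖ ^ 2 / μg) ^ 2 with hc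
    have hcpos : 0 < c := by positivity
    have hsq : ∀ k, ‖z (k + 1) - zs‖ ^ 2 ≤ (1 - lam k * c) * ‖z k - zs‖ ^ 2 := by
      intro k
      obtain ⟨w₁, s₁, w₂, s₂, d₁, d₂, e, e₀, e₁⟩ := hstep k
      rw [e₀, e₁]
      refine norm_relaxation_sq_le (hlam k).1.le (hlam k).2 ?_
      have i₁ := norm_sub_smul_sq_le hγ (mul_nonneg hβg hαB) hL.le (d₁.le_inner hgσ hgbot)
        (d₁.norm_le hL (hgL h1) hgbot)
      have i₂ := mul_nonneg hγ.le (hmono hfσ (mul_nonneg hβf hαA) hfbot d₂)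
      have hc' : 4 * γ * (βg * αB) / (1 + γ * (1 / μg * ‖B‖ ^ 2)) ^ 2 = c := by
        rw [hc]; congr 1 <;> ring
      rw [hc'] at i₁
      rw [norm_sub_smul_sq γ w₂, e]
      linarith
    constructor
    · intro k
      refine le_sqrt_mul_of_sq_le (norm_nonneg _) (norm_nonneg _) ((hsq k).trans_eq ?_)
      rw [hc]; ring
    · rintro ⟨ε, hε, hle⟩
      refine convergesLinearly_of_sq_le (Q := 1 - ε * c) ?_ (fun k => ?_) hsq
      · linarith [mul_pos hε hcpos]
      · linarith [mul_le_mul_of_nonneg_right (hle k) hcpos.le]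
  · obtain ⟨h1, h2, h3⟩ := hpos hμf hβf hαA h
    have hL : 0 < 1 / μf * ‖A‖ ^ 2 := by positivity
    set c := 4 * γ * βf * αA / (1 + γ * ‖A‖ ^ 2 / μf) ^ 2 with hc
    have hcpos : 0 < c := by positivity
    -- the cut-off at `1` keeps the contraction factor of the outer reflection nonnegative, so that
    -- the nonexpansiveness of the inner one can be applied
    have hcpos' : 0 < min c 1 := lt_min hcpos one_pos
    have hsq : ∀ k, ‖z (k + 1) - zs‖ ^ 2 ≤ (1 - lam k * min c 1) * ‖z k - zs‖ ^ 2 := by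
      intro k
      obtain ⟨w₁, s₁, w₂, s₂, d₁, d₂, e, e₀, e₁⟩ := hstep k
      rw [e₀, e₁]
      refine norm_relaxation_sq_le (hlam k).1.le (hlam k).2 ?_
      have i₁ := norm_sub_smul_sq_le hγ (mul_nonneg hβf hαA) hL.le (d₂.le_inner hfσ hfbot)
        (d₂.norm_le hL (hfL h1) hfbot)
      have i₂ := mul_nonneg hγ.le (hmono hgσ (mul_nonneg hβg hαB) hgbot d₁)
      have hc' : 4 * γ * (βf * αA) / (1 + γ * (1 / μf * ‖A‖ ^ 2)) ^ 2 = c := by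
        rw [hc]; congr 1 <;> ring
      rw [hc', e] at i₁
      have i₃ : ‖w₁ - γ • s₁‖ ^ 2 ≤ ‖w₁ + γ • s₁‖ ^ 2 := by
        rw [norm_sub_smul_sq]; linarith
      calc ‖w₂ - γ • s₂‖ ^ 2 ≤ (1 - c) * ‖w₁ - γ • s₁‖ ^ 2 := i₁
        _ ≤ (1 - min c 1) * ‖w₁ - γ • s₁‖ ^ 2 := by gcongr; exact min_le_left _ _
        _ ≤ (1 - min c 1) * ‖w₁ + γ • s₁‖ ^ 2 :=
          mul_le_mul_of_nonneg_left i₃ (sub_nonneg.2 (min_le_right _ _))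
    constructor
    · intro k
      obtain ⟨l0, l1⟩ := hlam k
      refine le_sqrt_mul_of_sq_le (norm_nonneg _) (norm_nonneg _) ((hsq k).trans ?_)
      have m0 : 0 ≤ min c (1 - lam k) := le_min hcpos.le (by linarith)
      have m1 : min c (1 - lam k) ≤ min c 1 := min_le_min_left c (by linarith)
      have m2 := mul_le_mul_of_nonneg_left m1 l0.le
      have m3 := mul_nonneg l0.le m0
      gcongr
      linarith
    · rintro ⟨ε, hε, hle⟩
      refine convergesLinearly_of_sq_le (Q := 1 - ε * min c 1) ?_ (fun k => ?_) hsq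
      · linarith [mul_pos hε hcpos']
      · linarith [mul_le_mul_of_nonneg_right (hle k) hcpos'.le]
  · obtain ⟨h1, h2, h3⟩ := hpos hμf hβg hαB h
    have hL : 0 < 1 / μf * ‖A‖ ^ 2 := by positivity
    set c := min (γ * βg * αB) (μf / (‖A‖ ^ 2 * γ)) with hc
    have hcpos : 0 < c := lt_min (by positivity) (by positivity)
    have hsq : ∀ k, ‖z (k + 1) - zs‖ ^ 2
        ≤ (1 - 4 * lam k * min c (1 - lam k) / 3) * ‖z k - zs‖ ^ 2 := by
      intro k
      obtain ⟨l0, l1⟩ := hlam k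
      obtain ⟨w₁, s₁, w₂, s₂, d₁, d₂, e, e₀, e₁⟩ := hstep k
      rw [e₀, e₁]
      refine norm_relaxed_step_sq_le_of_split (p := w₁) (q := -(γ • s₂)) l0.le e
        (le_min hcpos.le (by linarith)) (min_le_right _ _) ?_ ?_
      · have e' : γ • s₂ = w₁ - γ • s₁ - w₂ := by rw [← e]; abel
        rw [e']; module
      · rw [norm_neg, norm_smul, mul_pow, Real.norm_eq_abs, sq_abs]
        exact weighted_norm_sq_le hγ hL (d₁.le_inner hgσ hgbot)
          (d₂.norm_sq_le_inner hL (hfL h1) hfbot)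
          ((min_le_left _ _).trans ((min_le_left _ _).trans_eq (by ring)))
          ((min_le_left _ _).trans ((min_le_right _ _).trans_eq (by field_simp)))
    exact ⟨fun k => le_sqrt_mul_of_sq_le (norm_nonneg _) (norm_nonneg _) (hsq k),
      fun ⟨ε, hε, hle⟩ => convergesLinearly_of_sq_le_min hcpos hlam hε hle hsq⟩
  · obtain ⟨h1, h2, h3⟩ := hpos hμg hβf hαA h
    have hL : 0 < 1 / μg * ‖B‖ ^ 2 := by positivity
    set c := min (γ * βf * αA) (μg / (‖B‖ ^ 2 * γ)) with hc
    have hcpos : 0 < c := lt_min (by positivity) (by positivity)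
    have hsq : ∀ k, ‖z (k + 1) - zs‖ ^ 2
        ≤ (1 - 4 * lam k * min c (1 - lam k) / 3) * ‖z k - zs‖ ^ 2 := by
      intro k
      obtain ⟨l0, l1⟩ := hlam k
      obtain ⟨w₁, s₁, w₂, s₂, d₁, d₂, e, e₀, e₁⟩ := hstep k
      rw [e₀, e₁]
      refine norm_relaxed_step_sq_le_of_split (p := w₂) (q := γ • s₁) l0.le e
        (le_min hcpos.le (by linarith)) (min_le_right _ _) (by abel) ?_
      rw [norm_smul, mul_pow, Real.norm_eq_abs, sq_abs, add_comm (γ * _)]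
      exact weighted_norm_sq_le hγ hL (d₂.le_inner hfσ hfbot)
        (d₁.norm_sq_le_inner hL (hgL h1) hgbot)
        ((min_le_left _ _).trans ((min_le_left _ _).trans_eq (by ring)))
        ((min_le_left _ _).trans ((min_le_right _ _).trans_eq (by field_simp)))
    exact ⟨fun k => le_sqrt_mul_of_sq_le (norm_nonneg _) (norm_nonneg _) (hsq k),
      fun ⟨ε, hε, hle⟩ => convergesLinearly_of_sq_le_min hcpos hlam hε hle hsq⟩
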